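/- Let $n\ge 0$, let $A\subset\mathbb Z^n$ be a finite non-empty set and let $\nu\colon A\to\mathbb R$ induce a triangulation: for every affine function $\ell\colon\mathbb R^n\to\mathbb R$ with $\ell\le\nu$ on $A$, the set $\{\alpha\in A:\ell(\alpha)=\nu(\alpha)\}$ is affinely independent (every cell of the coherent subdivision induced by $\nu$ is a simplex whose marked points are exactly its vertices). For $\alpha\in A$ let $C_\alpha=\{u\in\mathbb R^n:\langle\beta,u\rangle-\nu(\beta)\le\langle\alpha,u\rangle-\nu(\alpha)\text{ for all }\beta\in A\}$, and for $t>1$ let $C_{\alpha,t}=\log(t)\,C_\alpha$. For $\epsilon,K>0$ and $t>1$, call a collection of $C^\infty$ functions $\phi_\alpha\colon\mathbb R^n\to[0,\infty)$, $\alpha\in A$, admissible if for all $\alpha\in A$ and $p\in\mathbb R^n$ $$d(p,C_{\alpha,t})\le\tfrac{\epsilon\log t}{2}\iff\phi_\alpha(p)=0,\qquad d(p,C_{\alpha,t})\ge\epsilon\log t\iff\phi_\alpha(p)=1,\qquad \sum_{i=1}^n\Bigl|\frac{\partial\phi_\alpha}{\partial u_i}(p)\Bigr|<\frac{K}{\epsilon\log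 t},$$ where $d$ is the Euclidean distance and $d(p,\emptyset)=+\infty$. For $z\in(\mathbb C^*)^n$ put $\operatorname{Log}(z)=(\log|z_1|,\dots,\log|z_n|)$ and $$f_{t,s}(z)=\sum_{\alpha\in A}t^{-\nu(\alpha)}\bigl(1-s\,\phi_\alpha(\operatorname{Log}(z))\bigr)z^\alpha,\qquad M_{t,s}=\{z\in(\mathbb C^*)^n:f_{t,s}(z)=0\}.$$ Equip $(\mathbb C^*)^n$ with the symplectic form $\omega=\sum_{j=1}^n\frac{dz_j\wedge d\bar z_j}{2i|z_j|^2}$. A symplectic hypersurface is a (possibly empty) closed subset of $(\mathbb C^*)^n$ that is a smooth submanifold of real codimension two to whose tangent spaces $\omega$ restricts nondegenerately. Then there is $\epsilon_0>0$ (depending on $A,\nu$) such that for all $0<\epsilon<\epsilon_0$ and all $K>0$ there is $T>1$ (depending on $A,\nu,\epsilon,K$) such that for all $t>T$ and every admissible collection $(\phi_\alpha)_{\alpha\in A}$ for $\epsilon,K,t$, the sets $M_{t,s}$, $s\in[0,1]$, form a smooth family of symplectic hypersurfaces of $(\mathbb C^*)^n$. That is, each $M_{t,s}$ is a symplectic hypersurface;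 the total space $\{(s,z):s\in[0,1],\ z\in M_{t,s}\}$ is closed in $[0,1]\times(\mathbb C^*)^n$; and near each of its points the total space is the zero set in $[0,1]\times(\mathbb C^*)^n$ of a complex-valued function, smooth in $(s,z)$, whose real differential in $z$ at that point is onto $\mathbb C$. -/

import Mathlib

open scoped Pointwise ContDiff

noncomputable section

namespace TropLoc

variable {n : ℕ}

/-! ### Tropical data: a finite set `A ⊆ ℤⁿ` of exponents and a height function `ν` on `A`
(values of `ν` off `A` play no role) -/

/-- The pairing `⟨α, u⟩` of a lattice vector with a point of `ℝⁿ`. -/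
def pair (α : Fin n → ℤ) (u : EuclideanSpace ℝ (Fin n)) : ℝ := ∑ i, (α i : ℝ) * u i

/-- `x ↦ ⟨x, u⟩ - c` is an affine function lying below `ν` on `A` (equivalently, below the
convex support of `ν` on the convex hull of `A`). -/
def IsAffineMinorant (A : Finset (Fin n → ℤ)) (ν : (Fin n → ℤ) → ℝ)
    (u : EuclideanSpace ℝ (Fin n)) (c : ℝ) : Prop :=
  ∀ α ∈ A, pair α u - c ≤ ν α

/-- The points of `A` at which `ν` agrees with the affine function `x ↦ ⟨x, u⟩ - c`. When that
function is an affine minorant, these are the marked points of a cell of the coherent subdivision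
induced by `ν`; the cell itself (the locus where the affine function agrees with the convex
support of `ν`) is their convex hull. -/
def cell (A : Finset (Fin n → ℤ)) (ν : (Fin n → ℤ) → ℝ)
    (u : EuclideanSpace ℝ (Fin n)) (c : ℝ) : Set (Fin n → ℤ) :=
  {α | α ∈ A ∧ pair α u - c = ν α}

/-- `ν` induces a (regular) triangulation: every cell of the coherent subdivision is a simplex
whose marked points are exactly its vertices. -/
def InducesTriangulation (A : Finset (Fin n → ℤ)) (ν : (Fin n → ℤ) → ℝ) : Prop :=
  ∀ (u : EuclideanSpace ℝ (Fin n)) (c : ℝ), IsAffineMinorant A ν u c →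
    AffineIndependent ℝ (fun α : cell A ν u c => fun i : Fin n => ((α : Fin n → ℤ) i : ℝ))

/-- The closed region `C_α ⊆ ℝⁿ` on which `⟨α, u⟩ - ν α` realizes the maximum
`max_{β ∈ A} (⟨β, u⟩ - ν β)`; it may be empty. -/
def region (A : Finset (Fin n → ℤ)) (ν : (Fin n → ℤ) → ℝ) (α : Fin n → ℤ) :
    Set (EuclideanSpace ℝ (Fin n)) :=
  {u | ∀ β ∈ A, pair β u - ν β ≤ pair α u - ν α}

/-- The rescaled region `C_{α,t} = log(t) C_α`. -/
def scaledRegion (A : Finset (Fin n → ℤ)) (ν : (Fin n → ℤ) → ℝ) (t : ℝ) (α : Fin n → ℤ) :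
    Set (EuclideanSpace ℝ (Fin n)) :=
  Real.log t • region A ν α

/-- Admissible cut-off functions `φ_α : ℝⁿ → ℝ`, `α ∈ A`, for the parameters `t`, `ε` and the
gradient constant `K`. Distances are extended-valued, so that a point is at infinite distance
from an empty region (and `φ_α = 1` in that case). -/
structure IsCutoff (A : Finset (Fin n → ℤ)) (ν : (Fin n → ℤ) → ℝ) (ε K t : ℝ)
    (φ : (Fin n → ℤ) → EuclideanSpace ℝ (Fin n) → ℝ) : Prop where
  smooth : ∀ α ∈ A, ContDiff ℝ ∞ (φ α)
  nonneg : ∀ α ∈ A, ∀ p, 0 ≤ φ α p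
  eq_zero_iff : ∀ α ∈ A, ∀ p,
    Metric.infEDist p (scaledRegion A ν t α) ≤ ENNReal.ofReal (ε * Real.log t / 2) ↔ φ α p = 0
  eq_one_iff : ∀ α ∈ A, ∀ p,
    ENNReal.ofReal (ε * Real.log t) ≤ Metric.infEDist p (scaledRegion A ν t α) ↔ φ α p = 1
  gradient : ∀ α ∈ A, ∀ p,
    ∑ i, |fderiv ℝ (φ α) p (EuclideanSpace.single i 1)| < K / (ε * Real.log t)

/-! ### The complex torus and the localized polynomials -/

/-- The complex torus `(ℂ*)ⁿ`, an open subset of `ℂⁿ`. -/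
def torus (n : ℕ) : Set (Fin n → ℂ) := {z | ∀ i, z i ≠ 0}

/-- `Log z = (log |z₁|, …, log |zₙ|)`. -/
def Log (z : Fin n → ℂ) : EuclideanSpace ℝ (Fin n) :=
  WithLp.toLp 2 fun i => Real.log ‖z i‖

/-- The Laurent monomial `z^α`. -/
def monomial (α : Fin n → ℤ) (z : Fin n → ℂ) : ℂ := ∏ i, z i ^ α i

/-- `f_{t,s}(z) = ∑_{α ∈ A} t^{-ν(α)} (1 - s φ_α(Log z)) z^α`. -/
def localized (A : Finset (Fin n → ℤ)) (ν : (Fin n → ℤ) → ℝ)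
    (φ : (Fin n → ℤ) → EuclideanSpace ℝ (Fin n) → ℝ) (t s : ℝ) (z : Fin n → ℂ) : ℂ :=
  ∑ α ∈ A, ((t ^ (-ν α) * (1 - s * φ α (Log z)) : ℝ) : ℂ) * monomial α z

/-- The zero set `M_{t,s}` of `f_{t,s}` in `(ℂ*)ⁿ`. -/
def zeroSet (A : Finset (Fin n → ℤ)) (ν : (Fin n → ℤ) → ℝ)
    (φ : (Fin n → ℤ) → EuclideanSpace ℝ (Fin n) → ℝ) (t s : ℝ) : Set (Fin n → ℂ) :=
  {z | z ∈ torus n ∧ localized A ν φ t s z = 0}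

/-! ### Symplectic hypersurfaces of the torus -/

/-- The symplectic form `ω = ∑ⱼ dzⱼ ∧ dz̄ⱼ / (2 i |zⱼ|²)` on `(ℂ*)ⁿ` at the point `z`, evaluated
on two tangent vectors; see `omega_eq`. -/
def omega (z v w : Fin n → ℂ) : ℝ := ∑ j, (v j * star (w j)).im / ‖z j‖ ^ 2

theorem omega_eq (z v w : Fin n → ℂ) :
    (omega z v w : ℂ) =
      ∑ j, (v j * star (w j) - w j * star (v j)) / (2 * Complex.I * (‖z j‖ : ℂ) ^ 2) := by
  unfold omega
  push_cast
  refine Finset.sum_congr rfl fun j _ => ?_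
  have h : v j * star (w j) - w j * star (v j)
      = 2 * Complex.I * (((v j * star (w j)).im : ℝ) : ℂ) := by
    apply Complex.ext
    · simp; ring
    · simp; ring
  rw [h, mul_div_mul_left _ _ (by simp)]

/-- `ω_z` is nondegenerate on the real subspace `W` of the tangent space at `z`. -/
def IsSymplecticSubspace (z : Fin n → ℂ) (W : Submodule ℝ (Fin n → ℂ)) : Prop :=
  ∀ v ∈ W, (∀ w ∈ W, omega z v w = 0) → v = 0

/-- `M` is a symplectic hypersurface of `(ℂ*)ⁿ`: a closed subset of `(ℂ*)ⁿ` which is a smooth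
submanifold of real codimension two (locally the zero set of a smooth complex-valued function `g`
whose real differential is onto `ℂ`, so that its tangent space is `ker dg`) and to whose tangent
spaces `ω` restricts nondegenerately. -/
def IsSymplecticHypersurface (M : Set (Fin n → ℂ)) : Prop :=
  (∃ F : Set (Fin n → ℂ), IsClosed F ∧ M = F ∩ torus n) ∧
  ∀ p ∈ M, ∃ (U : Set (Fin n → ℂ)) (g : (Fin n → ℂ) → ℂ),
    IsOpen U ∧ p ∈ U ∧ ContDiffOn ℝ ∞ g U ∧ (∀ z ∈ U, z ∈ M ↔ g z = 0) ∧
    Function.Surjective (fderiv ℝ g p) ∧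
    IsSymplecticSubspace p (LinearMap.ker (fderiv ℝ g p : (Fin n → ℂ) →ₗ[ℝ] ℂ))

/-- The subsets `M s` of `(ℂ*)ⁿ`, `s ∈ S`, form a smooth family of hypersurfaces: the total space
`{(s, z) | s ∈ S, z ∈ M s}` is closed in `S × (ℂ*)ⁿ`, and locally it is the zero set of a function
that is smooth in `(s, z)` jointly and whose real differential in `z` is onto `ℂ`. -/
def IsSmoothFamily (S : Set ℝ) (M : ℝ → Set (Fin n → ℂ)) : Prop :=
  (∃ F : Set (ℝ × (Fin n → ℂ)), IsClosed F ∧ ∀ s ∈ S, M s = {z | (s, z) ∈ F} ∩ torus n) ∧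
  ∀ s₀ ∈ S, ∀ p ∈ M s₀, ∃ (J : Set ℝ) (U : Set (Fin n → ℂ)) (G : ℝ × (Fin n → ℂ) → ℂ),
    IsOpen J ∧ s₀ ∈ J ∧ IsOpen U ∧ p ∈ U ∧ ContDiffOn ℝ ∞ G (J ×ˢ U) ∧
    (∀ s ∈ J ∩ S, ∀ z ∈ U, z ∈ M s ↔ G (s, z) = 0) ∧
    Function.Surjective (fderiv ℝ (fun z => G (s₀, z)) p)

/-- A smooth family, parametrized by `s ∈ S`, of symplectic hypersurfaces of `(ℂ*)ⁿ`. -/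
def IsSymplecticHypersurfaceFamily (S : Set ℝ) (M : ℝ → Set (Fin n → ℂ)) : Prop :=
  (∀ s ∈ S, IsSymplecticHypersurface (M s)) ∧ IsSmoothFamily S M

end TropLoc

end

/-! Write tangent vectors as `z i * ξ i`. In these logarithmic coordinates ω is, up to sign, the
imaginary part of the standard Hermitian product, and the differential of f_{t,s} is a
complex-linear form `inner ℂ a ξ` plus an error that comes only from the derivatives of the
cut-offs. A real-linear functional within ‖a‖‖ξ‖/3 of a nonzero complex-linear one is onto with
symplectic kernel (`surjective_and_isSymplecticSubspace`), so on the zero set `a` must be bounded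
below and the error above, both in units of the largest term c_{α₀} at z.

The error is O(1 / log t) times that term by the gradient bound. For `a`, put u = Log z / log t. The
exponents whose regions come within ε of u are vertices of one simplex (`exists_separating`), so
some x of norm at most R has ⟨α - α₀, x⟩ = 1 at all its other vertices. Combined with f_{t,s}(z) = 0
this makes the form take the value -c_{α₀} at x, up to the terms of far regions, which are
exponentially small in log t (`exists_gap`). Hence ‖a‖ ≥ ‖c_{α₀}‖ / (2R).

Both combinatorial lemmas must be uniform over the noncompact space of all u; this uniformity comes
from `exists_feasible_near`, proved by Fourier–Motzkin elimination. -/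

/-! ### Approximate solutions of linear inequalities -/

/-- Stability of systems of finitely many linear inequalities: an approximate solution is close to
an exact one. In particular, an inconsistent system has no approximate solutions. -/
theorem exists_feasible_near : ∀ (n : ℕ) {ι : Type} [Finite ι] (a : ι → Fin n → ℝ) (b : ι → ℝ)
    {η : ℝ}, 0 < η → ∃ δ : ℝ, 0 < δ ∧ ∀ x : Fin n → ℝ, (∀ i, ∑ j, a i j * x j ≤ b i + δ) →
      ∃ y : Fin n → ℝ, (∀ i, ∑ j, a i j * y j ≤ b i) ∧ ∀ j, |x j - y j| ≤ η
  | 0, ι, _, a, b, η, hη => by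
    by_cases h : ∀ i, 0 ≤ b i
    · exact ⟨1, one_pos, fun x _ => ⟨x, fun i => by simpa using h i, fun j => j.elim0⟩⟩
    · push Not at h
      obtain ⟨i, hi⟩ := h
      -- Without variables the system reads 0 ≤ b; this slack keeps a violated inequality violated.
      refine ⟨-b i / 2, by linarith, fun x hx => ?_⟩
      have := hx i
      simp at this
      linarith
  | n + 1, ι, _, a, b, η, hη => by
    obtain ⟨S, hS⟩ := (Set.finite_range fun i => ∑ j, |a i (Fin.succ j)|).bddAbove
    obtain ⟨C, hC⟩ := (Set.finite_range fun i => |a i 0|).bddAbove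
    obtain ⟨Q, hQ⟩ := (Set.finite_range fun i => |a i 0|⁻¹).bddAbove
    replace hS : ∀ i, ∑ j, |a i (Fin.succ j)| ≤ max S 1 := fun i =>
      (hS ⟨i, rfl⟩).trans (le_max_left _ _)
    replace hC : ∀ i, |a i 0| ≤ max C 1 := fun i => (hC ⟨i, rfl⟩).trans (le_max_left _ _)
    replace hQ : ∀ i, |a i 0|⁻¹ ≤ max Q 1 := fun i => (hQ ⟨i, rfl⟩).trans (le_max_left _ _)
    have hS1 : 1 ≤ max S 1 := le_max_right _ _
    have hC1 : 1 ≤ max C 1 := le_max_right _ _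
    have hQ1 : 1 ≤ max Q 1 := le_max_right _ _
    generalize max S 1 = S at *
    generalize max C 1 = C at *
    generalize max Q 1 = Q at *
    have hη' : 0 < η / (2 * S * Q) := by positivity
    -- Fourier–Motzkin: the first variable is eliminated by a positive combination of each upper
    -- bound with each lower bound. A slack δ becomes at most 2Cδ ≤ δ' in the new system.
    obtain ⟨δ', hδ', H⟩ := exists_feasible_near n
      (ι := {p : ι × ι // 0 < a p.1 0 ∧ a p.2 0 < 0} ⊕ {i : ι // a i 0 = 0})
      (Sum.elim (fun p j => -a p.1.2 0 * a p.1.1 (Fin.succ j) + a p.1.1 0 * a p.1.2 (Fin.succ j))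
        (fun i j => a i (Fin.succ j)))
      (Sum.elim (fun p => -a p.1.2 0 * b p.1.1 + a p.1.1 0 * b p.1.2) (fun i => b i)) hη'
    refine ⟨min (η / (2 * Q)) (δ' / (2 * C)), by positivity, fun x hx => ?_⟩
    set δ := min (η / (2 * Q)) (δ' / (2 * C))
    have hδ : 0 < δ := by positivity
    have hδ1 : δ * (2 * Q) ≤ η := (le_div_iff₀ (by positivity)).1 (min_le_left _ _)
    have hδ2 : δ * (2 * C) ≤ δ' := (le_div_iff₀ (by positivity)).1 (min_le_right _ _)
    simp only [Fin.sum_univ_succ] at hx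
    obtain ⟨y, hy, hxy⟩ := H (fun j => x (Fin.succ j)) (by
      rintro (⟨⟨i, k⟩, hi, hk⟩ | ⟨i, hi⟩)
      · have h1 := mul_le_mul_of_nonneg_left (hx i) (neg_pos.2 hk).le
        have h2 := mul_le_mul_of_nonneg_left (hx k) hi.le
        have h3 := hC i
        have h4 := hC k
        rw [abs_of_pos hi] at h3
        rw [abs_of_neg hk] at h4
        simp only [Sum.elim_inl, add_mul, Finset.sum_add_distrib, mul_assoc, ← Finset.mul_sum]
        dsimp only at *
        nlinarith
      · have := hx i
        simp only [Sum.elim_inr]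
        rw [hi] at this
        nlinarith)
    have key : ∀ i, |∑ j : Fin n, a i j.succ * x j.succ - ∑ j : Fin n, a i j.succ * y j| * Q
        ≤ η / 2 := by
      intro i
      have : |∑ j : Fin n, a i j.succ * x j.succ - ∑ j : Fin n, a i j.succ * y j|
          ≤ S * (η / (2 * S * Q)) := by
        rw [← Finset.sum_sub_distrib]
        refine (Finset.abs_sum_le_sum_abs _ _).trans ?_
        refine le_trans ?_ (mul_le_mul_of_nonneg_right (hS i) hη'.le)
        rw [Finset.sum_mul]
        refine Finset.sum_le_sum fun j _ => ?_
        rw [← mul_sub, abs_mul]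
        exact mul_le_mul_of_nonneg_left (hxy j) (abs_nonneg _)
      calc _ ≤ S * (η / (2 * S * Q)) * Q := by gcongr
        _ = η / 2 := by field_simp
    -- The bounds x 0 ± η, added to those imposed by the system, force the new coordinate to stay
    -- near the old one. They are compatible with the others because `key` and δ each cost at most η
    -- / 2 after division by |a i 0|.
    obtain ⟨y₀, hl, hu⟩ := exists_between_of_forall_le
      (s := insert (x 0 - η) {r | ∃ k, a k 0 < 0 ∧ r = (b k - ∑ j, a k (Fin.succ j) * y j) / a k 0})
      (t := insert (x 0 + η) {r | ∃ i, 0 < a i 0 ∧ r = (b i - ∑ j, a i (Fin.succ j) * y j) / a i 0})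
      ⟨_, Set.mem_insert _ _⟩ ⟨_, Set.mem_insert _ _⟩ (by
        have up : ∀ i, 0 < a i 0 → x 0 ≤ (b i - ∑ j, a i (Fin.succ j) * y j) / a i 0 + η := by
          intro i hi
          have h1 := hx i
          have h2 := key i
          have h3 := hQ i
          rw [abs_of_pos hi] at h3
          have h4 : 1 ≤ Q * a i 0 := by
            rwa [inv_le_iff_one_le_mul₀ hi] at h3
          rw [div_add' _ _ _ hi.ne', le_div_iff₀ hi]
          have h5 := neg_abs_le (∑ j : Fin n, a i j.succ * x j.succ - ∑ j : Fin n, a i j.succ * y j)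
          set D := |∑ j : Fin n, a i j.succ * x j.succ - ∑ j : Fin n, a i j.succ * y j|
          have h6 : D * Q + δ * Q ≤ η := by linarith
          have h7 : D + δ ≤ η * a i 0 := by
            have hD : 0 ≤ D := abs_nonneg _
            nlinarith [mul_le_mul_of_nonneg_right h6 hi.le]
          linarith
        have low : ∀ i, a i 0 < 0 → (b i - ∑ j, a i (Fin.succ j) * y j) / a i 0 ≤ x 0 + η := by
          intro i hi
          have h1 := hx i
          have h2 := key i
          have h3 := hQ i
          rw [abs_of_neg hi] at h3
          have h4 : 1 ≤ Q * -a i 0 := by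
            rwa [inv_le_iff_one_le_mul₀ (by linarith)] at h3
          rw [div_le_iff_of_neg hi]
          have h5 := neg_abs_le (∑ j : Fin n, a i j.succ * x j.succ - ∑ j : Fin n, a i j.succ * y j)
          set D := |∑ j : Fin n, a i j.succ * x j.succ - ∑ j : Fin n, a i j.succ * y j|
          have h6 : D * Q + δ * Q ≤ η := by linarith
          have h7 : D + δ ≤ η * -a i 0 := by
            have hD : 0 ≤ D := abs_nonneg _
            nlinarith [mul_le_mul_of_nonneg_right h6 (neg_pos.2 hi).le]
          linarith
        rintro _ (rfl | ⟨k, hk, rfl⟩) _ (rfl | ⟨i, hi, rfl⟩)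
        · linarith
        · linarith [up i hi]
        · exact low k hk
        · have := hy (Sum.inl ⟨(i, k), hi, hk⟩)
          simp only [Sum.elim_inl, add_mul, Finset.sum_add_distrib, mul_assoc,
            ← Finset.mul_sum] at this
          rw [div_le_iff_of_neg hk, div_mul_eq_mul_div, div_le_iff₀ hi]
          linarith)
    refine ⟨Fin.cons y₀ y, fun i => ?_, fun j => ?_⟩
    · simp only [Fin.sum_univ_succ, Fin.cons_zero, Fin.cons_succ]
      rcases lt_trichotomy (a i 0) 0 with hi | hi | hi
      · have := hl (Set.mem_insert_of_mem _ ⟨i, hi, rfl⟩)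
        rw [div_le_iff_of_neg hi] at this
        linarith
      · have := hy (Sum.inr ⟨i, hi⟩)
        simp only [Sum.elim_inr] at this
        rw [hi]
        linarith
      · have := hu (Set.mem_insert_of_mem _ ⟨i, hi, rfl⟩)
        rw [le_div_iff₀ hi] at this
        linarith
    · refine Fin.cases ?_ (fun j => ?_) j
      · have h1 := hl (Set.mem_insert _ _)
        have h2 := hu (Set.mem_insert _ _)
        simp only [Fin.cons_zero]
        rw [abs_le]
        constructor <;> linarith
      · simp only [Fin.cons_succ]
        refine (hxy j).trans (div_le_self hη.le ?_)
        nlinarith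

/-! ### Regions, cells and separating vectors -/

namespace TropLoc

variable {n : ℕ}

theorem pair_sub_right (α : Fin n → ℤ) (u v : EuclideanSpace ℝ (Fin n)) :
    pair α (u - v) = pair α u - pair α v := by
  simp [pair, mul_sub, Finset.sum_sub_distrib]

theorem pair_smul_right (α : Fin n → ℤ) (c : ℝ) (u : EuclideanSpace ℝ (Fin n)) :
    pair α (c • u) = c * pair α u := by
  simp only [pair, Finset.mul_sum, PiLp.smul_apply, smul_eq_mul]
  exact Finset.sum_congr rfl fun _ _ => by ring

theorem exists_abs_pair_le (A : Finset (Fin n → ℤ)) :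
    ∃ C : ℝ, 0 < C ∧ ∀ α ∈ A, ∀ u, |pair α u| ≤ C * ‖u‖ := by
  refine ⟨1 + ∑ α ∈ A, ∑ i, |(α i : ℝ)|, by positivity, fun α hα u => ?_⟩
  have h : ∑ i, |(α i : ℝ)| ≤ 1 + ∑ α ∈ A, ∑ i, |(α i : ℝ)| := by
    have := Finset.single_le_sum (f := fun α : Fin n → ℤ => ∑ i, |(α i : ℝ)|)
      (fun _ _ => by positivity) hα
    linarith
  refine le_trans ?_ (mul_le_mul_of_nonneg_right h (norm_nonneg u))
  rw [pair, Finset.sum_mul]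
  refine (Finset.abs_sum_le_sum_abs _ _).trans (Finset.sum_le_sum fun i _ => ?_)
  rw [abs_mul]
  exact mul_le_mul_of_nonneg_left (PiLp.norm_apply_le u i) (abs_nonneg _)

/-- A point at which all the terms in `B` nearly realize the maximum is close to a common point of
the regions of `B`. -/
theorem exists_mem_regions_near (A B : Finset (Fin n → ℤ)) (ν : (Fin n → ℤ) → ℝ) {η : ℝ}
    (hη : 0 < η) : ∃ δ : ℝ, 0 < δ ∧ ∀ u : EuclideanSpace ℝ (Fin n),
      (∀ α ∈ B, ∀ β ∈ A, pair β u - ν β ≤ pair α u - ν α + δ) →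
        ∃ y, (∀ α ∈ B, y ∈ region A ν α) ∧ ‖u - y‖ < η := by
  have hη' : 0 < η / (n + 1) := by positivity
  obtain ⟨δ, hδ, H⟩ := exists_feasible_near n (ι := B × A)
    (fun p j => (p.2.1 j : ℝ) - p.1.1 j) (fun p => ν p.2.1 - ν p.1.1) hη'
  have hpair : ∀ (α β : Fin n → ℤ) (v : EuclideanSpace ℝ (Fin n)),
      ∑ j, ((β j : ℝ) - α j) * v j = pair β v - pair α v := by
    intro α β v
    simp [pair, sub_mul, Finset.sum_sub_distrib]
  refine ⟨δ, hδ, fun u hu => ?_⟩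
  obtain ⟨y, hy, hxy⟩ := H u (fun p => by
    rw [hpair]
    linarith [hu p.1.1 p.1.2 p.2.1 p.2.2])
  refine ⟨WithLp.toLp 2 y, fun α hα β hβ => ?_, ?_⟩
  · have := hy (⟨α, hα⟩, ⟨β, hβ⟩)
    rw [hpair α β (WithLp.toLp 2 y)] at this
    linarith
  · rw [EuclideanSpace.norm_eq, Real.sqrt_lt' hη]
    calc ∑ i, ‖(u - WithLp.toLp 2 y) i‖ ^ 2 ≤ ∑ i : Fin n, (η / (n + 1)) ^ 2 := by
          refine Finset.sum_le_sum fun i _ => ?_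
          have := hxy i
          gcongr
          simpa using this
      _ = n * (η / (n + 1)) ^ 2 := by simp
      _ < (n + 1) ^ 2 * (η / (n + 1)) ^ 2 := by
          gcongr
          nlinarith [(Nat.cast_nonneg n : (0 : ℝ) ≤ n)]
      _ = η ^ 2 := by field_simp

/-- Contrapositive of `exists_mem_regions_near` for singletons, with the least of finitely many δ.
It covers an empty region, whose term is then beaten by δ everywhere. -/
theorem exists_gap (A : Finset (Fin n → ℤ)) (ν : (Fin n → ℤ) → ℝ) {ε : ℝ} (hε : 0 < ε) :
    ∃ δ : ℝ, 0 < δ ∧ ∀ α ∈ A, ∀ u, (∀ y ∈ region A ν α, ε ≤ ‖u - y‖) →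
      ∃ β ∈ A, pair α u - ν α + δ < pair β u - ν β := by
  choose δ hδ H using fun α => exists_mem_regions_near A {α} ν hε
  rcases A.eq_empty_or_nonempty with rfl | hA
  · exact ⟨1, one_pos, by simp⟩
  refine ⟨A.inf' hA δ, (Finset.lt_inf'_iff hA).2 fun α _ => hδ α, fun α hα u hu => ?_⟩
  by_contra! hcon
  obtain ⟨y, hy, hlt⟩ := H α u (by
    intro α' hα' β hβ
    rw [Finset.mem_singleton.1 hα']
    exact (hcon β hβ).trans (by gcongr; exact Finset.inf'_le δ hα))
  exact (hu y (hy α (by simp))).not_gt hlt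

/-- An affine function vanishing at one vertex of a simplex and equal to `1` at the others. -/
theorem _root_.AffineIndependent.exists_linearMap_eq_one {V ι : Type*} [AddCommGroup V]
    [Module ℝ V] {p : ι → V} (hp : AffineIndependent ℝ p) (i₀ : ι) :
    ∃ f : V →ₗ[ℝ] ℝ, ∀ i, i ≠ i₀ → f (p i - p i₀) = 1 := by
  rw [affineIndependent_iff_linearIndependent_vsub ℝ p i₀] at hp
  obtain ⟨f, hf⟩ := LinearMap.exists_extend ((Module.Basis.span hp).constr ℝ fun _ => (1 : ℝ))
  refine ⟨f, fun i hi => ?_⟩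
  have h1 := (Module.Basis.span hp).constr_basis ℝ (fun _ => (1 : ℝ)) ⟨i, hi⟩
  rw [← hf] at h1
  simpa [Module.Basis.span_apply] using h1

/-- A common point y of the regions is the slope of an affine minorant touching ν at every point of
B, so B lies in one cell and is affinely independent. -/
theorem exists_pair_eq_one_of_cell {A : Finset (Fin n → ℤ)} {ν : (Fin n → ℤ) → ℝ}
    (hν : InducesTriangulation A ν) {B : Finset (Fin n → ℤ)} (hB : B ⊆ A)
    {y : EuclideanSpace ℝ (Fin n)} (hy : ∀ α ∈ B, y ∈ region A ν α) {α₀ : Fin n → ℤ}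
    (h₀ : α₀ ∈ B) :
    ∃ x : EuclideanSpace ℝ (Fin n), ∀ α ∈ B, α ≠ α₀ → pair α x - pair α₀ x = 1 := by
  have hmin : IsAffineMinorant A ν y (pair α₀ y - ν α₀) := fun β hβ => by
    linarith [hy α₀ h₀ β hβ]
  have hmem : ∀ α ∈ B, α ∈ cell A ν y (pair α₀ y - ν α₀) := fun α hα =>
    ⟨hB hα, by linarith [hy α₀ h₀ α (hB hα), hy α hα α₀ (hB h₀)]⟩
  obtain ⟨f, hf⟩ := (hν y _ hmin).exists_linearMap_eq_one ⟨α₀, hmem α₀ h₀⟩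
  refine ⟨WithLp.toLp 2 fun i => f fun j => if i = j then 1 else 0, fun α hα hne => ?_⟩
  have h := hf ⟨α, hmem α hα⟩ (by simpa using hne)
  rw [LinearMap.pi_apply_eq_sum_univ f] at h
  simpa only [pair, ← Finset.sum_sub_distrib, ← sub_mul, Pi.sub_apply, smul_eq_mul] using h

/-- For small `ε₀`, the vertices whose regions come `ε₀`-close to a common point span a simplex. -/
theorem exists_separating {A : Finset (Fin n → ℤ)} {ν : (Fin n → ℤ) → ℝ}
    (hν : InducesTriangulation A ν) : ∃ ε₀ : ℝ, 0 < ε₀ ∧ ∃ R : ℝ, 0 < R ∧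
      ∀ B ⊆ A, ∀ u, (∀ α ∈ B, ∃ y ∈ region A ν α, ‖u - y‖ < ε₀) → ∀ α₀ ∈ B,
        ∃ x : EuclideanSpace ℝ (Fin n), ‖x‖ ≤ R ∧ ∀ α ∈ B, α ≠ α₀ →
          pair α x - pair α₀ x = 1 := by
  classical
  obtain ⟨C, hC, hCA⟩ := exists_abs_pair_le A
  choose δ hδ H using fun B => exists_mem_regions_near A B ν one_pos
  have hne : A.powerset.Nonempty := ⟨∅, by simp⟩
  have hδ₀ : 0 < A.powerset.inf' hne δ := (Finset.lt_inf'_iff hne).2 fun B _ => hδ B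
  let P : Finset (Fin n → ℤ) → (Fin n → ℤ) → EuclideanSpace ℝ (Fin n) → Prop := fun B α₀ x =>
    ∀ α ∈ B, α ≠ α₀ → pair α x - pair α₀ x = 1
  -- The required x depends only on B and α₀, not on u. One choice per pair gives finitely many
  -- vectors, hence a uniform R; choices for pairs admitting no x are harmless.
  let X : Finset (Fin n → ℤ) → (Fin n → ℤ) → EuclideanSpace ℝ (Fin n) := fun B α₀ =>
    Classical.epsilon (P B α₀)
  -- Moving u by less than this changes the two pairings being compared by less than δ in total.
  refine ⟨A.powerset.inf' hne δ / (2 * C), by positivity,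
    1 + ∑ B ∈ A.powerset, ∑ α ∈ A, ‖X B α‖, by positivity, fun B hB u hu α₀ h₀ => ?_⟩
  have hBδ : A.powerset.inf' hne δ ≤ δ B := Finset.inf'_le δ (Finset.mem_powerset.2 hB)
  obtain ⟨y, hy, -⟩ := H B u (by
    intro α hα β hβ
    obtain ⟨y, hy, hlt⟩ := hu α hα
    have h1 := hCA α (hB hα) (u - y)
    have h2 := hCA β hβ (u - y)
    rw [lt_div_iff₀ (by positivity)] at hlt
    have h3 := hy β hβ
    rw [pair_sub_right, abs_le] at h1 h2
    linarith [h1.1, h2.2])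
  refine ⟨X B α₀, ?_, Classical.epsilon_spec (p := P B α₀)
    (exists_pair_eq_one_of_cell hν hB hy h₀)⟩
  have h1 := Finset.single_le_sum (f := fun α => ‖X B α‖) (fun _ _ => norm_nonneg _) (hB h₀)
  have h2 := Finset.single_le_sum (f := fun B => ∑ α ∈ A, ‖X B α‖)
    (fun _ _ => by positivity) (Finset.mem_powerset.2 hB)
  linarith

end TropLoc

/-! ### Real-linear functionals close to complex-linear ones -/

section AlmostComplexLinear

variable {E : Type*} [NormedAddCommGroup E] [InnerProductSpace ℂ E]

theorem norm_le_norm_apply_smul {D : E →ₗ[ℝ] ℂ} {a : E}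
    (h : ∀ ξ, ‖D ξ - inner ℂ a ξ‖ ≤ ‖a‖ * ‖ξ‖ / 3) (c : ℂ) :
    2 / 3 * ‖a‖ ^ 2 * ‖c‖ ≤ ‖D (c • a)‖ := by
  have h1 := h (c • a)
  have h2 : ‖inner ℂ a (c • a)‖ = ‖c‖ * ‖a‖ ^ 2 := by
    rw [inner_smul_right, inner_self_eq_norm_sq_to_K, norm_mul]
    simp
  have h3 := norm_sub_norm_le (inner ℂ a (c • a)) (D (c • a))
  rw [norm_sub_rev, h2] at h3
  rw [norm_smul] at h1
  linarith

/-- A real-linear functional close to a nonzero complex-linear one is onto, already on the complex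
line dual to the latter. -/
theorem exists_apply_smul_eq {D : E →ₗ[ℝ] ℂ} {a : E} (ha : a ≠ 0)
    (h : ∀ ξ, ‖D ξ - inner ℂ a ξ‖ ≤ ‖a‖ * ‖ξ‖ / 3) (c : ℂ) : ∃ l : ℂ, D (l • a) = c := by
  let L : ℂ →ₗ[ℝ] ℂ := D.comp ((LinearMap.toSpanSingleton ℂ E a).restrictScalars ℝ)
  have hL : Function.Injective L := by
    rw [← LinearMap.ker_eq_bot, LinearMap.ker_eq_bot']
    intro l hl
    have h1 := norm_le_norm_apply_smul h l
    have h2 : D (l • a) = 0 := hl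
    rw [h2, norm_zero] at h1
    have h3 : 0 < 2 / 3 * ‖a‖ ^ 2 := by positivity
    exact norm_le_zero_iff.1 (nonpos_of_mul_nonpos_right h1 h3)
  exact LinearMap.injective_iff_surjective.1 hL c

/-- The kernel of a real-linear functional close to a nonzero complex-linear one is a symplectic
subspace. -/
theorem eq_zero_of_forall_im_inner_eq_zero {D : E →ₗ[ℝ] ℂ} {a : E} (ha : a ≠ 0)
    (h : ∀ ξ, ‖D ξ - inner ℂ a ξ‖ ≤ ‖a‖ * ‖ξ‖ / 3) {v : E} (hv : D v = 0)
    (hvw : ∀ w, D w = 0 → (inner ℂ v w).im = 0) : v = 0 := by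
  -- I • v pairs with v to ‖v‖² but may leave the kernel; subtracting l • a corrects this. Closeness
  -- gives ‖a‖‖l‖ ≤ ‖v‖ and ‖⟨a, v⟩‖ ≤ ‖a‖‖v‖ / 3, so the test yields ‖v‖² ≤ ‖v‖² / 3.
  obtain ⟨l, hl⟩ := exists_apply_smul_eq ha h (D (Complex.I • v))
  have h1 := hvw (Complex.I • v - l • a) (by rw [map_sub, hl, sub_self])
  rw [inner_sub_right, inner_smul_right, inner_smul_right, inner_self_eq_norm_sq_to_K] at h1
  have hav : ‖inner ℂ a v‖ ≤ ‖a‖ * ‖v‖ / 3 := by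
    have := h v
    rwa [hv, zero_sub, norm_neg] at this
  have h2 : ‖v‖ ^ 2 ≤ ‖l‖ * ‖inner ℂ a v‖ := by
    rw [← norm_inner_symm v a, ← norm_mul]
    refine le_trans (le_of_eq ?_) (Complex.im_le_norm _)
    have h3 : (Complex.I * ((‖v‖ : ℂ)) ^ 2).im = ‖v‖ ^ 2 := by
      rw [← Complex.ofReal_pow, Complex.I_mul_im, Complex.ofReal_re]
    rw [Complex.sub_im] at h1
    simp only [Complex.coe_algebraMap] at h1
    linarith
  have h3 := norm_le_norm_apply_smul h l
  rw [hl] at h3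
  have h4 : ‖D (Complex.I • v)‖ ≤ 2 * (‖a‖ * ‖v‖ / 3) := by
    have h5 := h (Complex.I • v)
    have h6 := norm_le_norm_sub_add (D (Complex.I • v)) (inner ℂ a (Complex.I • v))
    rw [inner_smul_right, norm_mul, Complex.norm_I, one_mul] at h6
    rw [norm_smul, Complex.norm_I, one_mul, inner_smul_right] at h5
    linarith
  have ha' : 0 < ‖a‖ := norm_pos_iff.2 ha
  have h5 : ‖a‖ * ‖l‖ ≤ ‖v‖ := by
    have : ‖a‖ * (‖a‖ * ‖l‖) ≤ ‖a‖ * ‖v‖ := by nlinarith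
    exact le_of_mul_le_mul_left this ha'
  have h6 : ‖v‖ ^ 2 ≤ ‖v‖ * ‖v‖ / 3 := by
    calc ‖v‖ ^ 2 ≤ ‖l‖ * (‖a‖ * ‖v‖ / 3) := h2.trans (by gcongr)
      _ = (‖a‖ * ‖l‖) * ‖v‖ / 3 := by ring
      _ ≤ ‖v‖ * ‖v‖ / 3 := by gcongr
  exact norm_eq_zero.1 (by nlinarith [norm_nonneg v])

end AlmostComplexLinear

/-! ### The localized polynomials in logarithmic coordinates -/

namespace TropLoc

variable {n : ℕ}

theorem isOpen_torus : IsOpen (torus n) := by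
  simp only [torus, Set.ofPred_forall]
  exact isOpen_iInter_of_finite fun i => isOpen_ne_fun (continuous_apply i) continuous_const

theorem contDiffAt_monomial (α : Fin n → ℤ) {z : Fin n → ℂ} (hz : z ∈ torus n) :
    ContDiffAt ℝ ∞ (monomial α) z := by
  unfold monomial
  refine contDiffAt_prod fun i _ => ?_
  have hi : ContDiffAt ℝ ∞ (fun z : Fin n → ℂ => z i) z := (contDiff_apply ℝ ℂ i).contDiffAt
  cases α i with
  | ofNat k => simpa using hi.pow k
  | negSucc k =>
    simp only [zpow_negSucc]
    exact (hi.pow (k + 1)).inv (pow_ne_zero _ (hz i))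

theorem contDiffAt_Log {z : Fin n → ℂ} (hz : z ∈ torus n) : ContDiffAt ℝ ∞ Log z := by
  unfold Log
  refine PiLp.contDiff_toLp.contDiffAt.comp z (contDiffAt_pi.2 fun i => ?_)
  have hi : ContDiffAt ℝ ∞ (fun z : Fin n → ℂ => z i) z := (contDiff_apply ℝ ℂ i).contDiffAt
  exact (hi.norm ℝ (hz i)).log (norm_ne_zero_iff.2 (hz i))

theorem contDiffOn_localized {A : Finset (Fin n → ℤ)} {ν : (Fin n → ℤ) → ℝ}
    {φ : (Fin n → ℤ) → EuclideanSpace ℝ (Fin n) → ℝ} (hφ : ∀ α ∈ A, ContDiff ℝ ∞ (φ α)) (t : ℝ) :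
    ContDiffOn ℝ ∞ (fun q : ℝ × (Fin n → ℂ) => localized A ν φ t q.1 q.2)
      (Set.univ ×ˢ torus n) := by
  rintro ⟨s, z⟩ ⟨-, hz⟩
  refine ContDiffAt.contDiffWithinAt ?_
  unfold localized
  have h2 : ContDiffAt ℝ ∞ (Prod.snd : ℝ × (Fin n → ℂ) → _) (s, z) := contDiffAt_snd
  refine ContDiffAt.sum fun α hα => ContDiffAt.mul ?_ ((contDiffAt_monomial α hz).comp (s, z) h2)
  refine Complex.ofRealCLM.contDiff.contDiffAt.comp (s, z) (contDiffAt_const.mul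
    (contDiffAt_const.sub (contDiffAt_fst.mul ?_)))
  exact (hφ α hα).contDiffAt.comp (s, z) ((contDiffAt_Log hz).comp (s, z) h2)

theorem contDiffOn_localized_right {A : Finset (Fin n → ℤ)} {ν : (Fin n → ℤ) → ℝ}
    {φ : (Fin n → ℤ) → EuclideanSpace ℝ (Fin n) → ℝ} (hφ : ∀ α ∈ A, ContDiff ℝ ∞ (φ α)) (t s : ℝ) :
    ContDiffOn ℝ ∞ (localized A ν φ t s) (torus n) :=
  (contDiffOn_localized hφ t).comp (f := fun z => (s, z))
    (contDiff_const.prodMk contDiff_id).contDiffOn fun _ hz => ⟨trivial, hz⟩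

theorem monomial_mul_exp (α : Fin n → ℤ) (z ξ : Fin n → ℂ) (r : ℝ) :
    monomial α (fun i => z i * Complex.exp (r * ξ i)) =
      monomial α z * Complex.exp (r * ∑ i, (α i : ℂ) * ξ i) := by
  simp only [monomial, mul_zpow, Finset.prod_mul_distrib, ← Complex.exp_int_mul, Finset.mul_sum,
    Complex.exp_sum]
  congr 1
  exact Finset.prod_congr rfl fun i _ => by ring_nf

theorem Log_mul_exp {z : Fin n → ℂ} (hz : z ∈ torus n) (ξ : Fin n → ℂ) (r : ℝ) :
    Log (fun i => z i * Complex.exp (r * ξ i)) =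
      Log z + r • WithLp.toLp 2 fun i => (ξ i).re := by
  ext i
  simp [Log, Complex.norm_exp, Real.log_mul (norm_ne_zero_iff.2 (hz i)) (Real.exp_ne_zero _)]

theorem norm_monomial (α : Fin n → ℤ) {z : Fin n → ℂ} (hz : z ∈ torus n) :
    ‖monomial α z‖ = Real.exp (pair α (Log z)) := by
  simp only [monomial, pair, Log, norm_prod, norm_zpow, Real.exp_sum]
  refine Finset.prod_congr rfl fun i _ => ?_
  rw [← Real.rpow_intCast, Real.rpow_def_of_pos (norm_pos_iff.2 (hz i)), mul_comm]

/-- The differential of `f_{t,s}` in logarithmic coordinates. -/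
theorem fderiv_localized {A : Finset (Fin n → ℤ)} {ν : (Fin n → ℤ) → ℝ}
    {φ : (Fin n → ℤ) → EuclideanSpace ℝ (Fin n) → ℝ} (hφ : ∀ α ∈ A, ContDiff ℝ ∞ (φ α)) (t s : ℝ)
    {z : Fin n → ℂ} (hz : z ∈ torus n) (ξ : Fin n → ℂ) :
    fderiv ℝ (localized A ν φ t s) z (fun i => z i * ξ i) =
      ∑ α ∈ A, (((t ^ (-ν α) * (1 - s * φ α (Log z)) : ℝ) : ℂ) * monomial α z *
          (∑ i, (α i : ℂ) * ξ i) -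
        ((s * fderiv ℝ (φ α) (Log z) (WithLp.toLp 2 fun i => (ξ i).re) : ℝ) : ℂ) *
          (((t ^ (-ν α) : ℝ) : ℂ) * monomial α z)) := by
  -- Along this curve monomials are exponentials and Log is affine in r.
  let γ : ℝ → Fin n → ℂ := fun r i => z i * Complex.exp (r * ξ i)
  have hγ0 : γ 0 = z := by simp [γ]
  have hlin : ∀ c : ℂ, HasDerivAt (fun r : ℝ => Complex.exp (r * c)) c 0 := by
    intro c
    have h := ((Complex.ofRealCLM.hasDerivAt (x := 0)).mul_const c).cexp
    simpa using h
  have hγ : HasDerivAt γ (fun i => z i * ξ i) 0 :=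
    hasDerivAt_pi.2 fun i => (hlin (ξ i)).const_mul (z i)
  have hdiff : DifferentiableAt ℝ (localized A ν φ t s) (γ 0) := by
    rw [hγ0]
    exact ((contDiffOn_localized_right hφ t s).contDiffAt (isOpen_torus.mem_nhds hz)).differentiableAt
      (by simp)
  have h1 := hdiff.hasFDerivAt.comp_hasDerivAt 0 hγ
  rw [hγ0] at h1
  refine h1.unique ?_
  have hcomp : localized A ν φ t s ∘ γ = fun r : ℝ => ∑ α ∈ A,
      ((t ^ (-ν α) * (1 - s * φ α (Log z + r • WithLp.toLp 2 fun i => (ξ i).re)) : ℝ) : ℂ) *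
        (monomial α z * Complex.exp (r * ∑ i, (α i : ℂ) * ξ i)) := by
    funext r
    simp only [Function.comp, localized, γ, monomial_mul_exp, Log_mul_exp hz]
  rw [hcomp]
  refine HasDerivAt.fun_sum fun α hα => ?_
  have hline : HasDerivAt (fun r : ℝ => Log z + r • WithLp.toLp 2 fun i => (ξ i).re)
      (WithLp.toLp 2 fun i => (ξ i).re) 0 := by
    simpa using ((hasDerivAt_id (0 : ℝ)).smul_const
      (WithLp.toLp 2 fun i => (ξ i).re : EuclideanSpace ℝ (Fin n))).const_add (Log z)
  have hφd : HasDerivAt (fun r : ℝ => φ α (Log z + r • WithLp.toLp 2 fun i => (ξ i).re))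
      (fderiv ℝ (φ α) (Log z) (WithLp.toLp 2 fun i => (ξ i).re)) 0 := by
    refine HasFDerivAt.comp_hasDerivAt 0 ?_ hline
    simpa using ((hφ α hα).differentiable (by simp) (Log z)).hasFDerivAt
  have h2 := (((hφd.const_mul s).const_sub 1).const_mul (t ^ (-ν α))).ofReal_comp.mul
    ((hlin (∑ i, (α i : ℂ) * ξ i)).const_mul (monomial α z))
  refine h2.congr_deriv ?_
  simp
  ring

/-- If `D` is close to a nonzero complex-linear functional in logarithmic coordinates, then it is
onto and its kernel is symplectic. -/
theorem surjective_and_isSymplecticSubspace {z : Fin n → ℂ} (hz : z ∈ torus n)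
    (D : (Fin n → ℂ) →L[ℝ] ℂ) {a : EuclideanSpace ℂ (Fin n)} (ha : a ≠ 0)
    (h : ∀ ξ : EuclideanSpace ℂ (Fin n),
      ‖D (fun i => z i * ξ i) - inner ℂ a ξ‖ ≤ ‖a‖ * ‖ξ‖ / 3) :
    Function.Surjective D ∧
      IsSymplecticSubspace z (LinearMap.ker (D : (Fin n → ℂ) →ₗ[ℝ] ℂ)) := by
  let L : EuclideanSpace ℂ (Fin n) →ₗ[ℝ] ℂ :=
    { toFun := fun ξ => D (fun i => z i * ξ i)
      map_add' := fun ξ ζ => by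
        rw [← map_add]
        congr 1
        ext i
        simp [mul_add]
      map_smul' := fun c ξ => by
        rw [RingHom.id_apply, ← map_smul]
        congr 1
        ext i
        simp [mul_left_comm] }
  have hL : ∀ ξ, ‖L ξ - inner ℂ a ξ‖ ≤ ‖a‖ * ‖ξ‖ / 3 := h
  refine ⟨fun c => ?_, fun v hv hvw => ?_⟩
  · obtain ⟨l, hl⟩ := exists_apply_smul_eq ha hL c
    exact ⟨_, hl⟩
  · have hback : ∀ v : Fin n → ℂ, (fun i => z i * (v i / z i)) = v := fun v =>
      funext fun i => mul_div_cancel₀ _ (hz i)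
    have hzero := eq_zero_of_forall_im_inner_eq_zero ha hL
      (v := WithLp.toLp 2 fun i => v i / z i)
      (by
        change D (fun i => z i * (v i / z i)) = 0
        rw [hback]
        exact hv) (by
        intro ζ hζ
        have h1 := hvw (fun i => z i * ζ i) hζ
        rw [omega] at h1
        rw [← inner_conj_symm, Complex.conj_im, neg_eq_zero, PiLp.inner_apply, Complex.im_sum, ← h1]
        refine Finset.sum_congr rfl fun i _ => ?_
        have hi : (v i : ℂ) * star (z i * ζ i) =
            ((‖z i‖ ^ 2 : ℝ) : ℂ) * (v i / z i * star (ζ i)) := by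
          have hzi := hz i
          rw [Complex.ofReal_pow, ← Complex.mul_conj', star_mul']
          simp only [← starRingEnd_apply]
          field_simp
        rw [hi, Complex.im_ofReal_mul, mul_div_cancel_left₀ _ (by simpa using hz i)]
        rfl)
    funext i
    have := congrArg (fun w : EuclideanSpace ℂ (Fin n) => w i) hzero
    simpa [hz i] using this

end TropLoc

/-! ### Estimates on the zero set -/

namespace TropLoc

variable {n : ℕ}

theorem IsCutoff.abs_fderiv_le {A : Finset (Fin n → ℤ)} {ν : (Fin n → ℤ) → ℝ} {ε K t : ℝ}
    {φ : (Fin n → ℤ) → EuclideanSpace ℝ (Fin n) → ℝ} (hφ : IsCutoff A ν ε K t φ)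
    {α : Fin n → ℤ} (hα : α ∈ A) (p : EuclideanSpace ℝ (Fin n)) (ξ : EuclideanSpace ℂ (Fin n)) :
    |fderiv ℝ (φ α) p (WithLp.toLp 2 fun i => (ξ i).re)| ≤ K / (ε * Real.log t) * ‖ξ‖ := by
  have hx : (WithLp.toLp 2 fun i => (ξ i).re : EuclideanSpace ℝ (Fin n)) =
      ∑ i, (ξ i).re • EuclideanSpace.single i (1 : ℝ) := by
    ext j
    simp [Finset.sum_apply, Pi.single_apply]
  rw [hx, map_sum]
  refine le_trans ?_ (mul_le_mul_of_nonneg_right (hφ.gradient α hα p).le (norm_nonneg ξ))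
  rw [Finset.sum_mul]
  refine (Finset.abs_sum_le_sum_abs _ _).trans (Finset.sum_le_sum fun i _ => ?_)
  rw [map_smul, smul_eq_mul, abs_mul, mul_comm]
  exact mul_le_mul_of_nonneg_left ((Complex.abs_re_le_norm _).trans (PiLp.norm_apply_le ξ i))
    (abs_nonneg _)

theorem IsCutoff.eq_zero_of_mem {A : Finset (Fin n → ℤ)} {ν : (Fin n → ℤ) → ℝ} {ε K t : ℝ}
    {φ : (Fin n → ℤ) → EuclideanSpace ℝ (Fin n) → ℝ} (hφ : IsCutoff A ν ε K t φ)
    {α : Fin n → ℤ} (hα : α ∈ A) {u : EuclideanSpace ℝ (Fin n)} (hu : u ∈ region A ν α) :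
    φ α (Real.log t • u) = 0 := by
  rw [← hφ.eq_zero_iff α hα, scaledRegion,
    Metric.infEDist_zero_of_mem (Set.smul_mem_smul_set hu)]
  exact zero_le

theorem IsCutoff.eq_one_of_far {A : Finset (Fin n → ℤ)} {ν : (Fin n → ℤ) → ℝ} {ε K t : ℝ}
    {φ : (Fin n → ℤ) → EuclideanSpace ℝ (Fin n) → ℝ} (hφ : IsCutoff A ν ε K t φ)
    (ht : 0 ≤ Real.log t) {α : Fin n → ℤ} (hα : α ∈ A) {u : EuclideanSpace ℝ (Fin n)}
    (hu : ∀ y ∈ region A ν α, ε ≤ ‖u - y‖) : φ α (Real.log t • u) = 1 := by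
  rw [← hφ.eq_one_iff α hα, Metric.le_infEDist]
  rintro _ ⟨y, hy, rfl⟩
  dsimp only
  rw [edist_dist, dist_eq_norm, ← smul_sub, norm_smul, Real.norm_of_nonneg ht, mul_comm]
  exact ENNReal.ofReal_le_ofReal (mul_le_mul_of_nonneg_left (hu y hy) ht)

/-- On the zero set of `f_{t,s}`, the complex-linear part of its differential, in logarithmic
coordinates, is bounded below by the largest monomial. -/
theorem norm_le_sum_of_localized_eq_zero {A : Finset (Fin n → ℤ)} {ν : (Fin n → ℤ) → ℝ}
    {ε K t s δ C R : ℝ} {φ : (Fin n → ℤ) → EuclideanSpace ℝ (Fin n) → ℝ}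
    (hφ : IsCutoff A ν ε K t φ) (hs : s ∈ Set.Icc (0 : ℝ) 1) (ht : 0 < Real.log t)
    (hC : 0 < C) (hR : 0 < R) (hpair : ∀ α ∈ A, ∀ u, |pair α u| ≤ C * ‖u‖)
    (hgap : ∀ α ∈ A, ∀ u, (∀ y ∈ region A ν α, ε ≤ ‖u - y‖) →
      ∃ β ∈ A, pair α u - ν α + δ < pair β u - ν β)
    (hsep : ∀ B ⊆ A, ∀ u, (∀ α ∈ B, ∃ y ∈ region A ν α, ‖u - y‖ < ε) → ∀ α₀ ∈ B,
      ∃ x : EuclideanSpace ℝ (Fin n), ‖x‖ ≤ R ∧ ∀ α ∈ B, α ≠ α₀ → pair α x - pair α₀ x = 1)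
    (hlog : 2 * (A.card * (2 * C * R + 1)) ≤ Real.log t * δ) (hε : 0 < ε)
    {u : EuclideanSpace ℝ (Fin n)} {c : (Fin n → ℤ) → ℂ}
    (hc : ∀ α ∈ A, ‖c α‖ = Real.exp (Real.log t * (pair α u - ν α)))
    (hzero : ∑ α ∈ A, ((1 - s * φ α (Real.log t • u) : ℝ) : ℂ) * c α = 0)
    {α₀ : Fin n → ℤ} (hα₀ : α₀ ∈ A) (hmax : u ∈ region A ν α₀) :
    ∃ x : EuclideanSpace ℝ (Fin n), ‖x‖ ≤ R ∧ ‖c α₀‖ / 2 ≤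
      ‖∑ α ∈ A, ((1 - s * φ α (Real.log t • u) : ℝ) : ℂ) * c α * (pair α x : ℂ)‖ := by
  classical
  -- Outside B the cut-off equals 1 and the gap δ applies, so those terms are negligible.
  set B := A.filter fun α => ∃ y ∈ region A ν α, ‖u - y‖ < ε with hB
  have h₀ : α₀ ∈ B := Finset.mem_filter.2 ⟨hα₀, u, hmax, by simpa using hε⟩
  obtain ⟨x, hxR, hx⟩ := hsep B (Finset.filter_subset _ _) u
    (fun α hα => (Finset.mem_filter.1 hα).2) α₀ h₀
  refine ⟨x, hxR, ?_⟩
  set w : (Fin n → ℤ) → ℂ := fun α => ((1 - s * φ α (Real.log t • u) : ℝ) : ℂ) * c α with hw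
  have hw₀ : w α₀ = c α₀ := by simp [hw, hφ.eq_zero_of_mem hα₀ hmax]
  -- Since ∑ w α = 0, the constant ⟨α₀, x⟩ + 1 may be subtracted from ⟨α, x⟩. On B the difference
  -- vanishes except at α₀, where it is -1.
  have hsum : (∑ α ∈ A, w α * (pair α x : ℂ)) + c α₀ =
      ∑ α ∈ A, if α ∈ B then 0 else w α * ((pair α x - pair α₀ x - 1 : ℝ) : ℂ) := by
    have h1 : ∑ α ∈ A, w α * ((pair α x - pair α₀ x - 1 : ℝ) : ℂ) =
        ∑ α ∈ A, w α * (pair α x : ℂ) := by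
      have : ∀ α, w α * ((pair α x - pair α₀ x - 1 : ℝ) : ℂ) =
          w α * (pair α x : ℂ) - w α * (pair α₀ x + 1 : ℂ) := fun α => by push_cast; ring
      simp only [this, Finset.sum_sub_distrib, ← Finset.sum_mul]
      rw [hzero]
      simp
    have h2 : c α₀ = ∑ α ∈ A, if α = α₀ then w α₀ else 0 := by
      rw [Finset.sum_ite_eq' A α₀, if_pos hα₀, hw₀]
    rw [← h1, h2, ← Finset.sum_add_distrib]
    refine Finset.sum_congr rfl fun α hα => ?_
    by_cases hαB : α ∈ B
    · rw [if_pos hαB]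
      by_cases hne : α = α₀
      · simp [hne]
      · simp [hx α hαB hne, hne]
    · have hne : α ≠ α₀ := fun h => hαB (h ▸ h₀)
      simp [hαB, hne]
  have hexp : A.card * (2 * C * R + 1) ≤ Real.exp (Real.log t * δ) / 2 := by
    linarith [Real.add_one_le_exp (Real.log t * δ)]
  have hterm : ∀ α ∈ A, ‖if α ∈ B then 0 else w α * ((pair α x - pair α₀ x - 1 : ℝ) : ℂ)‖ ≤
      (2 * C * R + 1) * (‖c α₀‖ * (Real.exp (Real.log t * δ))⁻¹) := by
    intro α hα
    split_ifs with hαB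
    · rw [norm_zero]
      positivity
    have hfar : ∀ y ∈ region A ν α, ε ≤ ‖u - y‖ := by
      intro y hy
      by_contra! hlt
      exact hαB (Finset.mem_filter.2 ⟨hα, y, hy, hlt⟩)
    have hwα : ‖w α‖ ≤ ‖c α‖ := by
      simp only [hw, hφ.eq_one_of_far ht.le hα hfar, norm_mul, Complex.norm_real]
      refine mul_le_of_le_one_left (norm_nonneg _) ?_
      rw [Real.norm_eq_abs, abs_le]
      constructor <;> linarith [hs.1, hs.2]
    have hcα : ‖c α‖ ≤ ‖c α₀‖ * (Real.exp (Real.log t * δ))⁻¹ := by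
      obtain ⟨β, hβ, hlt⟩ := hgap α hα u hfar
      rw [hc α hα, hc α₀ hα₀, ← Real.exp_neg, ← Real.exp_add, Real.exp_le_exp]
      nlinarith [hmax β hβ]
    have hlin : ‖((pair α x - pair α₀ x - 1 : ℝ) : ℂ)‖ ≤ 2 * C * R + 1 := by
      rw [Complex.norm_real, Real.norm_eq_abs]
      have h1 := hpair α hα x
      have h2 := hpair α₀ hα₀ x
      have h3 : C * ‖x‖ ≤ C * R := by gcongr
      rw [abs_le] at *
      constructor <;> linarith [h1.1, h1.2, h2.1, h2.2]
    rw [norm_mul, mul_comm]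
    exact mul_le_mul hlin (hwα.trans hcα) (norm_nonneg _) (by positivity)
  have hrest : ‖(∑ α ∈ A, w α * (pair α x : ℂ)) + c α₀‖ ≤ ‖c α₀‖ / 2 := by
    rw [hsum]
    refine (norm_sum_le_of_le A hterm).trans ?_
    rw [Finset.sum_const, nsmul_eq_mul, ← mul_assoc]
    calc _ ≤ Real.exp (Real.log t * δ) / 2 * (‖c α₀‖ * (Real.exp (Real.log t * δ))⁻¹) := by gcongr
      _ = ‖c α₀‖ / 2 := by field_simp
  have h4 := norm_sub_le ((∑ α ∈ A, w α * (pair α x : ℂ)) + c α₀) (∑ α ∈ A, w α * (pair α x : ℂ))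
  rw [add_sub_cancel_left] at h4
  linarith

theorem norm_term {t : ℝ} (ht : 0 < t) (hlog : Real.log t ≠ 0) (ν : (Fin n → ℤ) → ℝ)
    (α : Fin n → ℤ) {z : Fin n → ℂ} (hz : z ∈ torus n) :
    ‖((t ^ (-ν α) : ℝ) : ℂ) * monomial α z‖ =
      Real.exp (Real.log t * (pair α ((Real.log t)⁻¹ • Log z) - ν α)) := by
  rw [norm_mul, norm_monomial α hz, Complex.norm_real, Real.norm_of_nonneg (by positivity),
    Real.rpow_def_of_pos ht, ← Real.exp_add, pair_smul_right, mul_sub, mul_inv_cancel_left₀ hlog]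
  ring_nf

/-- On the zero set of `f_{t,s}`, the differential of `f_{t,s}` in logarithmic coordinates is close
to a nonzero complex-linear functional. -/
theorem exists_near_complexLinear {A : Finset (Fin n → ℤ)} (hA : A.Nonempty)
    {ν : (Fin n → ℤ) → ℝ} {ε K t s δ C R : ℝ} {φ : (Fin n → ℤ) → EuclideanSpace ℝ (Fin n) → ℝ}
    (hφ : IsCutoff A ν ε K t φ) (hs : s ∈ Set.Icc (0 : ℝ) 1) (ht : 1 < t)
    (hC : 0 < C) (hR : 0 < R) (hpair : ∀ α ∈ A, ∀ u, |pair α u| ≤ C * ‖u‖)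
    (hgap : ∀ α ∈ A, ∀ u, (∀ y ∈ region A ν α, ε ≤ ‖u - y‖) →
      ∃ β ∈ A, pair α u - ν α + δ < pair β u - ν β)
    (hsep : ∀ B ⊆ A, ∀ u, (∀ α ∈ B, ∃ y ∈ region A ν α, ‖u - y‖ < ε) → ∀ α₀ ∈ B,
      ∃ x : EuclideanSpace ℝ (Fin n), ‖x‖ ≤ R ∧ ∀ α ∈ B, α ≠ α₀ → pair α x - pair α₀ x = 1)
    (hlog : 2 * (A.card * (2 * C * R + 1)) ≤ Real.log t * δ)
    (hlogK : 6 * R * A.card * K ≤ ε * Real.log t) (hε : 0 < ε) (hK : 0 < K)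
    {z : Fin n → ℂ} (hz : z ∈ zeroSet A ν φ t s) :
    ∃ a : EuclideanSpace ℂ (Fin n), a ≠ 0 ∧ ∀ ξ : EuclideanSpace ℂ (Fin n),
      ‖fderiv ℝ (localized A ν φ t s) z (fun i => z i * ξ i) - inner ℂ a ξ‖ ≤
        ‖a‖ * ‖ξ‖ / 3 := by
  obtain ⟨hzt, hz0⟩ := hz
  have hτ := Real.log_pos ht
  set u := (Real.log t)⁻¹ • Log z with hu
  have hLog : Log z = Real.log t • u := by rw [hu, smul_inv_smul₀ hτ.ne']
  set c : (Fin n → ℤ) → ℂ := fun α => ((t ^ (-ν α) : ℝ) : ℂ) * monomial α z with hcdef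
  have hc : ∀ α ∈ A, ‖c α‖ = Real.exp (Real.log t * (pair α u - ν α)) := fun α _ =>
    norm_term (by linarith) hτ.ne' ν α hzt
  have hcoef : ∀ α, ((t ^ (-ν α) * (1 - s * φ α (Log z)) : ℝ) : ℂ) * monomial α z =
      ((1 - s * φ α (Real.log t • u) : ℝ) : ℂ) * c α := fun α => by
    rw [hLog, hcdef]
    push_cast
    ring
  obtain ⟨α₀, hα₀, hmax⟩ := A.exists_max_image (fun α => pair α u - ν α) hA
  have hcle : ∀ α ∈ A, ‖c α‖ ≤ ‖c α₀‖ := fun α hα => by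
    rw [hc α hα, hc α₀ hα₀, Real.exp_le_exp]
    exact mul_le_mul_of_nonneg_left (hmax α hα) hτ.le
  have hc₀ : 0 < ‖c α₀‖ := by rw [hc α₀ hα₀]; exact Real.exp_pos _
  obtain ⟨x, hxR, hx⟩ := norm_le_sum_of_localized_eq_zero hφ hs hτ hC hR hpair hgap hsep hlog hε hc
    (by rw [← hz0, localized]; exact Finset.sum_congr rfl fun α _ => (hcoef α).symm) hα₀ hmax
  set w : (Fin n → ℤ) → ℂ := fun α => ((1 - s * φ α (Real.log t • u) : ℝ) : ℂ) * c α with hw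
  -- The conjugate compensates for the inner product being conjugate-linear in its first slot.
  set a : EuclideanSpace ℂ (Fin n) := WithLp.toLp 2 fun i => star (∑ α ∈ A, w α * (α i : ℂ))
  have ha : ∀ ξ : EuclideanSpace ℂ (Fin n),
      inner ℂ a ξ = ∑ α ∈ A, w α * ∑ i, (α i : ℂ) * ξ i := by
    intro ξ
    simp only [a, PiLp.inner_apply, RCLike.inner_apply, starRingEnd_apply, star_star,
      Finset.mul_sum]
    rw [Finset.sum_comm]
    refine Finset.sum_congr rfl fun α _ => Finset.sum_congr rfl fun i _ => ?_
    ring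
  have hnorm : ‖c α₀‖ / 2 ≤ ‖a‖ * R := by
    have h1 : inner ℂ a (WithLp.toLp 2 fun i => (x i : ℂ)) = ∑ α ∈ A, w α * (pair α x : ℂ) := by
      rw [ha]
      simp [pair]
    have h2 : ‖(WithLp.toLp 2 fun i => (x i : ℂ) : EuclideanSpace ℂ (Fin n))‖ = ‖x‖ := by
      simp [EuclideanSpace.norm_eq]
    have h3 := norm_inner_le_norm (𝕜 := ℂ) a (WithLp.toLp 2 fun i => (x i : ℂ))
    rw [h1, h2] at h3
    exact hx.trans (h3.trans (by gcongr))
  refine ⟨a, ?_, fun ξ => ?_⟩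
  · rintro h
    rw [h, norm_zero] at hnorm
    linarith
  · have hD : fderiv ℝ (localized A ν φ t s) z (fun i => z i * ξ i) - inner ℂ a ξ =
        -∑ α ∈ A, ((s * fderiv ℝ (φ α) (Log z) (WithLp.toLp 2 fun i => (ξ i).re) : ℝ) : ℂ) *
          c α := by
      rw [fderiv_localized hφ.smooth t s hzt, ha, ← Finset.sum_sub_distrib,
        ← Finset.sum_neg_distrib]
      refine Finset.sum_congr rfl fun α _ => ?_
      rw [hcoef]
      ring
    have hterm : ∀ α ∈ A,
        ‖((s * fderiv ℝ (φ α) (Log z) (WithLp.toLp 2 fun i => (ξ i).re) : ℝ) : ℂ) * c α‖ ≤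
          K / (ε * Real.log t) * ‖ξ‖ * ‖c α₀‖ := by
      intro α hα
      rw [norm_mul, Complex.norm_real, Real.norm_eq_abs, abs_mul, abs_of_nonneg hs.1]
      refine mul_le_mul ?_ (hcle α hα) (norm_nonneg _) (by positivity)
      exact (mul_le_of_le_one_left (abs_nonneg _) hs.2).trans (hφ.abs_fderiv_le hα _ ξ)
    rw [hD, norm_neg]
    refine (norm_sum_le_of_le A hterm).trans ?_
    rw [Finset.sum_const, nsmul_eq_mul]
    -- With ‖c α₀‖ ≤ 2R‖a‖ this produces exactly the factor 1 / 3.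
    have hbound : A.card * (K / (ε * Real.log t)) ≤ 1 / (6 * R) := by
      rw [← mul_div_assoc, div_le_div_iff₀ (by positivity) (by positivity)]
      linarith
    calc (A.card : ℝ) * (K / (ε * Real.log t) * ‖ξ‖ * ‖c α₀‖)
        = A.card * (K / (ε * Real.log t)) * ‖ξ‖ * ‖c α₀‖ := by ring
      _ ≤ 1 / (6 * R) * ‖ξ‖ * (2 * (‖a‖ * R)) := by
          gcongr
          linarith
      _ = ‖a‖ * ‖ξ‖ / 3 := by
          field_simp
          ring

/-- A criterion for the zero sets of the `f_{t,s}` to form a family of symplectic hypersurfaces. -/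
theorem isSymplecticHypersurfaceFamily_zeroSet {A : Finset (Fin n → ℤ)} {ν : (Fin n → ℤ) → ℝ}
    {t : ℝ} {φ : (Fin n → ℤ) → EuclideanSpace ℝ (Fin n) → ℝ} (hφ : ∀ α ∈ A, ContDiff ℝ ∞ (φ α))
    {S : Set ℝ} (h : ∀ s ∈ S, ∀ z ∈ zeroSet A ν φ t s,
      ∃ a : EuclideanSpace ℂ (Fin n), a ≠ 0 ∧ ∀ ξ : EuclideanSpace ℂ (Fin n),
        ‖fderiv ℝ (localized A ν φ t s) z (fun i => z i * ξ i) - inner ℂ a ξ‖ ≤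
          ‖a‖ * ‖ξ‖ / 3) :
    IsSymplecticHypersurfaceFamily S fun s => zeroSet A ν φ t s := by
  have hmem : ∀ s, ∀ z ∈ torus n, z ∈ zeroSet A ν φ t s ↔ localized A ν φ t s z = 0 :=
    fun s z hz => ⟨fun hm => hm.2, fun hm => ⟨hz, hm⟩⟩
  refine ⟨fun s hs => ⟨?_, fun p hp => ?_⟩, ?_, fun s hs p hp => ?_⟩
  · obtain ⟨F, hF, hFe⟩ := continuousOn_iff_isClosed.1
      (contDiffOn_localized_right (ν := ν) hφ t s).continuousOn {0} isClosed_singleton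
    exact ⟨F, hF, hFe ▸ Set.ext fun z => ⟨fun hz => ⟨hz.2, hz.1⟩, fun hz => ⟨hz.2, hz.1⟩⟩⟩
  · obtain ⟨a, ha, hD⟩ := h s hs p hp
    obtain ⟨hsurj, hsymp⟩ := surjective_and_isSymplecticSubspace hp.1 _ ha hD
    exact ⟨torus n, localized A ν φ t s, isOpen_torus, hp.1, contDiffOn_localized_right hφ t s,
      hmem s, hsurj, hsymp⟩
  · obtain ⟨F, hF, hFe⟩ := continuousOn_iff_isClosed.1
      (contDiffOn_localized (ν := ν) hφ t).continuousOn {0} isClosed_singleton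
    refine ⟨F, hF, fun s _ => Set.ext fun z => ?_⟩
    have h1 := Set.ext_iff.1 hFe (s, z)
    simp only [Set.mem_inter_iff, Set.mem_preimage, Set.mem_singleton_iff, Set.mem_prod,
      Set.mem_univ, true_and] at h1
    exact and_comm.trans h1
  · obtain ⟨a, ha, hD⟩ := h s hs p hp
    exact ⟨Set.univ, torus n, fun q => localized A ν φ t q.1 q.2, isOpen_univ, trivial,
      isOpen_torus, hp.1, contDiffOn_localized hφ t, fun s _ z hz => hmem s z hz,
      (surjective_and_isSymplecticSubspace hp.1 _ ha hD).1⟩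

end TropLoc

/-! ### Choice of constants -/

theorem proposition4p1 (n : ℕ) (A : Finset (Fin n → ℤ)) (hA : A.Nonempty)
    (ν : (Fin n → ℤ) → ℝ) (hν : TropLoc.InducesTriangulation A ν) :
    ∃ ε₀ : ℝ, 0 < ε₀ ∧ ∀ ε : ℝ, 0 < ε → ε < ε₀ → ∀ K : ℝ, 0 < K →
      ∃ T : ℝ, 1 < T ∧ ∀ t : ℝ, T < t →
        ∀ φ : (Fin n → ℤ) → EuclideanSpace ℝ (Fin n) → ℝ, TropLoc.IsCutoff A ν ε K t φ →
          TropLoc.IsSymplecticHypersurfaceFamily (Set.Icc (0 : ℝ) 1)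
            (fun s => TropLoc.zeroSet A ν φ t s) := by
  obtain ⟨C, hC, hpair⟩ := TropLoc.exists_abs_pair_le A
  obtain ⟨ε₀, hε₀, R, hR, hsep⟩ := TropLoc.exists_separating hν
  refine ⟨ε₀, hε₀, fun ε hε hlt K hK => ?_⟩
  obtain ⟨δ, hδ, hgap⟩ := TropLoc.exists_gap A ν hε
  have hcard : 0 < (A.card : ℝ) := Nat.cast_pos.2 hA.card_pos
  -- log t > `a` makes the far terms negligible; log t > `b` makes the cut-off derivatives small.
  set a := 2 * (A.card * (2 * C * R + 1)) / δ with ha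
  set b := 6 * R * A.card * K / ε with hb
  refine ⟨Real.exp (a + b), Real.one_lt_exp_iff.2 (by positivity), fun t ht φ hφ => ?_⟩
  have ht0 : 0 < t := (Real.exp_pos _).trans ht
  have ht1 : 1 < t := (Real.one_lt_exp_iff.2 (by positivity)).trans ht
  have hlog : a + b < Real.log t := (Real.lt_log_iff_exp_lt ht0).2 ht
  have ha0 : 0 < a := by positivity
  have hb0 : 0 < b := by positivity
  have hloga : 2 * (A.card * (2 * C * R + 1)) ≤ Real.log t * δ :=
    (div_le_iff₀ hδ).1 (by linarith)
  have hlogb : 6 * R * A.card * K ≤ ε * Real.log t := (div_le_iff₀' hε).1 (by linarith)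
  refine TropLoc.isSymplecticHypersurfaceFamily_zeroSet hφ.smooth fun s hs z hz => ?_
  exact TropLoc.exists_near_complexLinear hA hφ hs ht1 hC hR hpair hgap
    (fun B hB u hu => hsep B hB u fun α hα => (hu α hα).imp fun y hy => ⟨hy.1, hy.2.trans hlt⟩)
    hloga hlogb hε hK hz
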